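/- **Proposition 1.3.** Let $m,n\ge 1$ be integers, let $1<q<\infty$, $1<p_1,\dots,p_m<\infty$ and $\frac1p=\sum_{i=1}^m\frac1{p_i}$. Let $\mathcal H^m(q)$ be the set of all $(s_1,\dots,s_m)\in\mathbb R^m$ such that $$\sum_{i=1}^m \alpha_i s_i+\frac{|\alpha|-1}{q}<|\alpha|\qquad\text{for all }\alpha\in\{0,1\}^m,\quad\text{where } |\alpha|=\sum_{i=1}^m\alpha_i .$$ For a function $\Omega$ on the unit sphere $\mathbb S^{mn-1}$ of $\mathbb R^{mn}=(\mathbb R^n)^m$ put $K(w)=\Omega(w/|w|)\,|w|^{-mn}$ for $w\ne0$, and $$T^m_\Omega(f_1,\dots,f_m)(x)=\lim_{\varepsilon\to0^+}\int_{\{y\in(\mathbb R^n)^m:\ |(x-y_1,\dots,x-y_m)|>\varepsilon\}}K(x-y_1,\dots,x-y_m)\prod_{i=1}^m f_i(y_i)\,dy$$ whenever the integrals and the limit exist in $[-\infty,\infty]$ (an integral exists if the positive or the negative part of the integrand has a finite integral). If $\left(\frac1{p_1},\dots,\frac1{p_m}\right)\notin\mathcal H^m(q)$ (in particular, if equality holds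 in one of the conditions above), then there exist an odd function $\Omega\in L^q(\mathbb S^{mn-1})$ and functions $f_i\in L^{p_i}(\mathbb R^n)$, $i=1,\dots,m$, such that $T^m_\Omega(f_1,\dots,f_m)\notin L^p(\mathbb R^n)$, in the sense that $$\int |T^m_\Omega(f_1,\dots,f_m)(x)|^p\,dx=\infty,$$ where the integral extends over those $x\in\mathbb R^n$ at which $T^m_\Omega(f_1,\dots,f_m)(x)$ exists in $[-\infty,\infty]$. -/

import Mathlib

open MeasureTheory Filter Topology

noncomputable section

/-- `ℝⁿ` with its Euclidean norm. -/
abbrev RSpace (n : ℕ) : Type := EuclideanSpace ℝ (Fin n)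

/-- `ℝ^{mn} = (ℝⁿ)^m` with its Euclidean norm, `‖y‖² = ‖y₁‖² + ⋯ + ‖y_m‖²`. -/
abbrev RProd (m n : ℕ) : Type := PiLp 2 (fun _ : Fin m => RSpace n)

/-- The unit sphere `𝕊^{mn-1}` of `ℝ^{mn}`. -/
abbrev USphere (m n : ℕ) : Type := Metric.sphere (0 : RProd m n) 1

/-- Surface measure on `𝕊^{mn-1}`. -/
def surfaceMeasure (m n : ℕ) : Measure (USphere m n) :=
  (volume : Measure (RProd m n)).toSphere

/-- The region `𝓗^m(q)`, as a set of vectors `s = (1/p₁, …, 1/p_m)`. -/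
def HRegion (m : ℕ) (q : ℝ) : Set (Fin m → ℝ) :=
  {s | ∀ α : Fin m → Fin 2,
    ∑ i, ((α i : ℕ) : ℝ) * s i + (∑ i, ((α i : ℕ) : ℝ) - 1) / q < ∑ i, ((α i : ℕ) : ℝ)}

open Classical in
/-- The homogeneous kernel `K(w) = Ω(w / |w|) / |w|^{mn}`, for `w ≠ 0`. -/
def roughKernel {m n : ℕ} (Ω : USphere m n → ℝ) (w : RProd m n) : ℝ :=
  if hw : w ≠ 0 then
    Ω ⟨‖w‖⁻¹ • w, by simp [norm_smul, hw]⟩ / ‖w‖ ^ (m * n)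
  else 0

/-- The point `(x - y₁, …, x - y_m)` of `ℝ^{mn}`. -/
def diagSub {m n : ℕ} (x : RSpace n) (y : Fin m → RSpace n) : RProd m n :=
  WithLp.toLp 2 (fun i => x - y i)

/-- `h` has the integral `v ∈ [-∞, ∞]` with respect to `μ`, in the extended sense: at least one of
the positive and the negative part of `h` has a finite integral. -/
def HasExtIntegral {X : Type*} [MeasurableSpace X] (μ : Measure X) (h : X → ℝ) (v : EReal) :
    Prop :=
  AEMeasurable h μ ∧
  ((∫⁻ y, ENNReal.ofReal (h y) ∂μ) ≠ ⊤ ∨ (∫⁻ y, ENNReal.ofReal (-h y) ∂μ) ≠ ⊤) ∧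
  v = ((∫⁻ y, ENNReal.ofReal (h y) ∂μ : ENNReal) : EReal) -
    ((∫⁻ y, ENNReal.ofReal (-h y) ∂μ : ENNReal) : EReal)

/-- The principal value `lim_{ε → 0+} ∫_{|(x-y₁,…,x-y_m)| > ε} K(x-y₁,…,x-y_m) ∏ fᵢ(yᵢ) dy`
exists in `[-∞, ∞]` and equals `v`. -/
def HasPrincipalValue {m n : ℕ} (Ω : USphere m n → ℝ) (f : Fin m → RSpace n → ℝ)
    (x : RSpace n) (v : EReal) : Prop :=
  ∃ I : ℝ → EReal,
    (∀ ε : ℝ, 0 < ε →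
      HasExtIntegral (volume.restrict {y : Fin m → RSpace n | ε < ‖diagSub x y‖})
        (fun y => roughKernel Ω (diagSub x y) * ∏ i, f i (y i)) (I ε)) ∧
    Tendsto I (𝓝[>] 0) (𝓝 v)

open Classical in
/-- The multilinear singular integral `T^m_Ω(f₁, …, f_m)(x)`, with values in `[-∞, ∞]`. It is the
principal value where this exists. It is set to `0` elsewhere, so that points at which the
principal value does not exist never contribute to the size of `T^m_Ω(f₁, …, f_m)`. -/
def roughT {m n : ℕ} (Ω : USphere m n → ℝ) (f : Fin m → RSpace n → ℝ) (x : RSpace n) : EReal :=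
  if h : ∃ v, HasPrincipalValue Ω f x v then h.choose else 0

end

/-! The violated inequality belongs to a set `A = insert k S` with `S` nonempty: empty sets never
violate it, and singletons do not because every `p_i > 1`. It reads `∑_{i ∈ A} 1/p_i ≥ |S| + 1 -
|S|/q`.

Let `d` be the distance to the partial diagonal `w_i = w_k`, `i ∈ S`, which has codimension `n|S|`.
Take `Ω` of size `d^{-n|S|/q} / log(1/d)`. The logarithm keeps it in `L^q` because `q > 1`
(`memLp_diagSingular`). A sign depending on one coordinate of `w_k` makes it odd. For `i ∈ A` let
`f_i` be indicators of fixed unit balls. For the other indices let `f_i` be `|y|^{-n/p_i} (log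
|y|)^{-a_i}` at infinity, with `a_i > 1/p_i`.

If `|x| ~ 2^L` in a suitable direction, the sign is positive on the support of `f_k`, so no
cancellation occurs and the principal value is a Lebesgue integral (`roughT_testFun`). The clustered
points put `(x - y_i)_i`, after normalization, at distance about `2^{-L}` from the diagonal, where
the kernel is about `2^{L(n|S|/q - mn)} / L` (`le_roughKernel_diagSingular`). Integrating over
`|y_i| < 2^L`, `i ∉ A`, gives `T ≳ 2^{-Lσ} L^{-τ}` (`exists_le_roughT_testFun`). The violated
inequality is exactly `σ ≤ n/p`. It also forces `∑_{i ∈ A} 1/p_i > 1`, which leaves room to choose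
the `a_i` with `τ ≤ 1/p`. Since the set of such `x` has measure about `2^{Ln}`, `∫ |T|^p` dominates
the harmonic series (`lintegral_rpow_eq_top_of_dyadicWeight_le`). -/

/-! ### Dyadic levels and logarithmically corrected power weights -/

/-- The integer part of `log₂ t`, with the value `0` for `t < 1`. -/
noncomputable def dyadicIndex (t : ℝ) : ℕ := Nat.log 2 ⌊t⌋₊

lemma measurable_dyadicIndex : Measurable dyadicIndex :=
  (measurable_from_top (f := Nat.log 2)).comp Nat.measurable_floor

lemma le_dyadicIndex {t : ℝ} {j : ℕ} (h : (2 : ℝ) ^ j ≤ t) : j ≤ dyadicIndex t := by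
  have h2 : 2 ^ j ≤ ⌊t⌋₊ := Nat.le_floor (by exact_mod_cast h)
  have : ⌊t⌋₊ ≠ 0 := (lt_of_lt_of_le (by positivity) h2).ne'
  exact (Nat.le_log_iff_pow_le one_lt_two this).2 h2

lemma dyadicIndex_le {t : ℝ} {j : ℕ} (h : t < (2 : ℝ) ^ (j + 1)) : dyadicIndex t ≤ j := by
  unfold dyadicIndex
  rcases eq_or_ne ⌊t⌋₊ 0 with h0 | h0
  · simp [h0]
  · rw [← Nat.lt_succ_iff]
    refine (Nat.log_lt_iff_lt_pow one_lt_two h0).2 ?_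
    have ht : 0 ≤ t := by
      by_contra hc
      exact h0 (Nat.floor_of_nonpos (not_le.1 hc).le)
    exact (Nat.floor_lt ht).2 (by exact_mod_cast h)

lemma lt_two_pow_dyadicIndex_succ (t : ℝ) : t < (2 : ℝ) ^ (dyadicIndex t + 1) := by
  by_contra h
  have := le_dyadicIndex (not_lt.1 h)
  omega

lemma two_pow_dyadicIndex_le {t : ℝ} (h : dyadicIndex t ≠ 0) : (2 : ℝ) ^ dyadicIndex t ≤ t := by
  by_contra hc
  obtain ⟨j, hj⟩ := Nat.exists_eq_succ_of_ne_zero h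
  rw [hj] at hc
  have := dyadicIndex_le (not_le.1 hc)
  omega

/-- The weight `2^{-sj} (j + 1)^{-a}`. -/
noncomputable def dyadicWeight (s a : ℝ) (j : ℕ) : ℝ :=
  (2 : ℝ) ^ (-(s * j)) * ((j : ℝ) + 1) ^ (-a)

lemma dyadicWeight_pos (s a : ℝ) (j : ℕ) : 0 < dyadicWeight s a j := by
  unfold dyadicWeight; positivity

lemma dyadicWeight_anti {s a : ℝ} (hs : 0 ≤ s) (ha : 0 ≤ a) {i j : ℕ} (h : i ≤ j) :
    dyadicWeight s a j ≤ dyadicWeight s a i := by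
  unfold dyadicWeight
  have h' : (i : ℝ) ≤ j := by exact_mod_cast h
  apply mul_le_mul
  · apply Real.rpow_le_rpow_of_exponent_le (by norm_num)
    have := mul_le_mul_of_nonneg_left h' hs
    linarith
  · exact Real.rpow_le_rpow_of_nonpos (by positivity) (by linarith) (by linarith)
  · positivity
  · positivity

lemma dyadicWeight_rpow {s a r : ℝ} (j : ℕ) :
    dyadicWeight s a j ^ r = dyadicWeight (s * r) (a * r) j := by
  unfold dyadicWeight
  rw [Real.mul_rpow (by positivity) (by positivity), ← Real.rpow_mul (by norm_num),
    ← Real.rpow_mul (by positivity)]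
  ring_nf

lemma dyadicWeight_mul_two_rpow (s a : ℝ) (j : ℕ) :
    dyadicWeight s a j * (2 : ℝ) ^ (s * j) = ((j : ℝ) + 1) ^ (-a) := by
  unfold dyadicWeight
  rw [mul_right_comm, ← Real.rpow_add (by norm_num)]
  simp

lemma summable_succ_rpow_neg {a : ℝ} (ha : 1 < a) :
    Summable (fun j : ℕ => ((j : ℝ) + 1) ^ (-a)) := by
  have := (summable_nat_add_iff 1).2 (Real.summable_nat_rpow.2 (show -a < -1 by linarith))
  simpa using this

/-- A dyadic step function whose levels have measure `O(2^{sj})` and values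
`2^{-sj/r} (j + 1)^{-a}` with `ar > 1` belongs to `L^r`. -/
lemma memLp_dyadicWeight_comp {X : Type*} [MeasurableSpace X] {μ : Measure X} {g : X → ℕ}
    (hg : Measurable g) {s a r : ℝ} (hr : 0 < r) (har : 1 < a * r) {C : ENNReal} (hC : C ≠ ⊤)
    (hμ : ∀ j, μ (g ⁻¹' {j}) ≤ C * ENNReal.ofReal ((2 : ℝ) ^ (s * j))) :
    MemLp (fun x => dyadicWeight (s / r) a (g x)) (ENNReal.ofReal r) μ := by
  refine ⟨((measurable_from_top (f := dyadicWeight (s / r) a)).comp hg).aestronglyMeasurable, ?_⟩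
  rw [eLpNorm_lt_top_iff_lintegral_rpow_enorm_lt_top (by simpa using hr) (by simp),
    ENNReal.toReal_ofReal hr.le]
  have h1 : ∀ x, ‖dyadicWeight (s / r) a (g x)‖ₑ ^ r =
      ENNReal.ofReal (dyadicWeight s (a * r) (g x)) := by
    intro x
    rw [Real.enorm_of_nonneg (dyadicWeight_pos _ _ _).le,
      ENNReal.ofReal_rpow_of_pos (dyadicWeight_pos _ _ _), dyadicWeight_rpow,
      div_mul_cancel₀ _ hr.ne']
  simp_rw [h1]
  rw [← lintegral_map (μ := μ) (g := g)
    (f := fun j => ENNReal.ofReal (dyadicWeight s (a * r) j)) measurable_from_top hg,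
    lintegral_countable']
  calc _ ≤ ∑' j : ℕ, C * ENNReal.ofReal (((j : ℝ) + 1) ^ (-(a * r))) := by
        refine ENNReal.tsum_le_tsum fun j => ?_
        rw [Measure.map_apply hg (measurableSet_singleton j), ← dyadicWeight_mul_two_rpow s,
          ENNReal.ofReal_mul (dyadicWeight_pos _ _ _).le]
        calc _ ≤ _ := mul_le_mul_right (hμ j) _
          _ = _ := by ring
    _ < ⊤ := by
        rw [ENNReal.tsum_mul_left]
        exact ENNReal.mul_lt_top hC.lt_top (summable_succ_rpow_neg har).tsum_ofReal_lt_top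

/-- A radial dyadic function on `ℝⁿ` in `L^r`. -/
lemma memLp_dyadicWeight_norm {n : ℕ} (hn : 1 ≤ n) {a r : ℝ} (hr : 0 < r) (har : 1 < a * r) :
    MemLp (fun y : RSpace n => dyadicWeight (n / r) a (dyadicIndex ‖y‖)) (ENNReal.ofReal r)
      volume := by
  have : Nonempty (Fin n) := ⟨⟨0, hn⟩⟩
  refine memLp_dyadicWeight_comp (g := fun y : RSpace n => dyadicIndex ‖y‖)
    (measurable_dyadicIndex.comp measurable_norm) hr har
    (C := ENNReal.ofReal (2 ^ n) * volume (Metric.ball (0 : RSpace n) 1))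
    (ENNReal.mul_ne_top (by simp) measure_ball_lt_top.ne) fun j => ?_
  calc _ ≤ volume (Metric.ball (0 : RSpace n) (2 ^ (j + 1))) := by
        refine measure_mono fun y hy => ?_
        simp only [Set.mem_preimage, Set.mem_singleton_iff] at hy
        rw [mem_ball_zero_iff, ← hy]
        exact lt_two_pow_dyadicIndex_succ _
    _ = _ := by
        rw [Measure.addHaar_ball _ _ (by positivity), finrank_euclideanSpace_fin, mul_right_comm,
          ← ENNReal.ofReal_mul (by positivity)]
        congr 2
        rw [mul_comm (n : ℝ), Real.rpow_mul (by norm_num), Real.rpow_natCast, Real.rpow_natCast]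
        ring

/-! ### Measure of neighbourhoods of a partial diagonal -/

/-- The distance `max_{i ∈ S} |w_i - w_k|`. -/
noncomputable def diagGap {m n : ℕ} (S : Finset (Fin m)) (k : Fin m) (w : Fin m → RSpace n) : ℝ :=
  ‖fun i => if i ∈ S then w i - w k else 0‖

lemma continuous_diagGap {m n : ℕ} (S : Finset (Fin m)) (k : Fin m) :
    Continuous (diagGap (n := n) S k) := by
  unfold diagGap
  refine continuous_norm.comp (continuous_pi fun i => ?_)
  split_ifs <;> fun_prop

lemma diagGap_nonneg {m n : ℕ} (S : Finset (Fin m)) (k : Fin m) (w : Fin m → RSpace n) :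
    0 ≤ diagGap S k w := norm_nonneg _

lemma diagGap_smul {m n : ℕ} (S : Finset (Fin m)) (k : Fin m) (c : ℝ) (w : Fin m → RSpace n) :
    diagGap S k (c • w) = |c| * diagGap S k w := by
  unfold diagGap
  rw [← Real.norm_eq_abs, ← norm_smul]
  congr 1
  ext1 i
  by_cases h : i ∈ S <;> simp [h, smul_sub]

lemma norm_sub_le_diagGap {m n : ℕ} {S : Finset (Fin m)} (k : Fin m) (w : Fin m → RSpace n)
    {i : Fin m} (hi : i ∈ S) : ‖w i - w k‖ ≤ diagGap S k w := by
  simpa [hi, diagGap] using norm_le_pi_norm (fun i => if i ∈ S then w i - w k else 0) i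

lemma diagGap_le {m n : ℕ} {S : Finset (Fin m)} {k : Fin m} {w : Fin m → RSpace n} {r : ℝ}
    (hr : 0 ≤ r) (h : ∀ i ∈ S, ‖w i - w k‖ ≤ r) : diagGap S k w ≤ r := by
  refine (pi_norm_le_iff_of_nonneg hr).2 fun i => ?_
  by_cases hi : i ∈ S
  · simpa [hi] using h i hi
  · simpa [hi] using hr

/-- Fubini with `w k` as outer variable: each coordinate in `S` is confined to a ball of radius `δ`
about `w k`, and each remaining one to the unit ball. -/
lemma volume_diagGap_le {m n : ℕ} (hn : 1 ≤ n) {S : Finset (Fin m)} {k : Fin m} (hk : k ∉ S)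
    {δ : ℝ} (hδ : 0 ≤ δ) :
    volume {w : Fin m → RSpace n | (∀ i, ‖w i‖ ≤ 1) ∧ diagGap S k w ≤ δ} ≤
      volume (Metric.closedBall (0 : RSpace n) 1) ^ m * ENNReal.ofReal (δ ^ (n * S.card)) := by
  have : Nonempty (Fin n) := ⟨⟨0, hn⟩⟩
  obtain ⟨M, rfl⟩ : ∃ M, m = M + 1 := ⟨m - 1, by have := k.2; omega⟩
  set v := volume (Metric.closedBall (0 : RSpace n) 1) with hv
  set U : Set (Fin (M + 1) → RSpace n) := {w | (∀ i, ‖w i‖ ≤ 1) ∧ diagGap S k w ≤ δ} with hU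
  set W : Set (RSpace n × (Fin M → RSpace n)) := {z | ‖z.1‖ ≤ 1 ∧
    ∀ i, (k.succAbove i ∈ S → ‖z.2 i - z.1‖ ≤ δ) ∧ (k.succAbove i ∉ S → ‖z.2 i‖ ≤ 1)} with hW
  have hWm : MeasurableSet W := by
    refine IsClosed.measurableSet ?_
    simp only [hW, Set.ofPred_and, Set.ofPred_forall]
    refine (isClosed_le (by fun_prop) (by fun_prop)).inter (isClosed_iInter fun i => ?_)
    refine (isClosed_iInter fun _ => isClosed_le (by fun_prop) (by fun_prop)).inter
      (isClosed_iInter fun _ => isClosed_le (by fun_prop) (by fun_prop))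
  have hmp := volume_preserving_piFinSuccAbove (fun _ : Fin (M + 1) => RSpace n) k
  have hsub : U ⊆ MeasurableEquiv.piFinSuccAbove (fun _ : Fin (M + 1) => RSpace n) k ⁻¹' W := by
    rintro w ⟨h1, h2⟩
    refine ⟨h1 k, fun i => ⟨fun hi => ?_, fun _ => h1 _⟩⟩
    exact (norm_sub_le_diagGap k w hi).trans h2
  calc volume U ≤ volume W := by
        rw [← hmp.measure_preimage hWm.nullMeasurableSet]
        exact measure_mono hsub
    _ = ∫⁻ y : RSpace n, volume (Prod.mk y ⁻¹' W) := Measure.prod_apply hWm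
    _ ≤ ∫⁻ y : RSpace n, (Metric.closedBall (0 : RSpace n) 1).indicator
          (fun _ => v ^ M * ENNReal.ofReal (δ ^ (n * S.card))) y := by
        refine lintegral_mono fun y => ?_
        by_cases hy : ‖y‖ ≤ 1
        · rw [Set.indicator_of_mem (by simpa using hy)]
          calc _ ≤ volume (Set.univ.pi fun i : Fin M =>
                  if k.succAbove i ∈ S then Metric.closedBall y δ
                  else Metric.closedBall (0 : RSpace n) 1) := by
                refine measure_mono fun z hz i _ => ?_
                have := hz.2 i
                by_cases hi : k.succAbove i ∈ S
                · simpa [hi, dist_eq_norm] using this.1 hi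
                · simpa [hi] using this.2 hi
            _ = ∏ i : Fin M, v * (if k.succAbove i ∈ S then ENNReal.ofReal (δ ^ n) else 1) := by
                rw [volume_pi_pi]
                refine Finset.prod_congr rfl fun i _ => ?_
                split_ifs
                · rw [Measure.addHaar_closedBall' _ _ hδ, finrank_euclideanSpace_fin, mul_comm]
                · simp [hv]
            _ = _ := by
                rw [Finset.prod_mul_distrib, Finset.prod_const, Finset.card_univ, Fintype.card_fin]
                congr 1
                -- As `k ∉ S`, the factor at `k` is `1`, so the product over the indices other than
                -- `k` still counts all of `S`.
                have h3 := Fin.prod_univ_succAbove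
                  (fun i => if i ∈ S then ENNReal.ofReal (δ ^ n) else 1) k
                simp only [hk, if_false, one_mul] at h3
                rw [← h3, Finset.prod_ite_mem, Finset.univ_inter, Finset.prod_const,
                  ← ENNReal.ofReal_pow (by positivity), pow_mul]
        · have : Prod.mk y ⁻¹' W = ∅ := by
            ext z
            simp [hW, hy]
          simp [this]
    _ = _ := by
        rw [lintegral_indicator_const measurableSet_closedBall, pow_succ]
        ring

/-- The volume of `(ℝⁿ)^m` as a Euclidean space is a finite multiple of the product measure. -/
lemma exists_volume_toLp_le (m n : ℕ) : ∃ c : ENNReal, c ≠ ⊤ ∧ ∀ s : Set (RProd m n),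
    volume s ≤ c * volume ((fun w : Fin m → RSpace n => (WithLp.toLp 2 w : RProd m n)) ⁻¹' s) := by
  let e : RProd m n ≃L[ℝ] (Fin m → RSpace n) := PiLp.continuousLinearEquiv 2 ℝ _
  have : (Measure.map e (volume : Measure (RProd m n))).IsAddHaarMeasure :=
    e.isAddHaarMeasure_map _
  refine ⟨(Measure.addHaarScalarFactor (Measure.map e (volume : Measure (RProd m n)))
    (volume : Measure (Fin m → RSpace n)) : ENNReal), ENNReal.coe_ne_top, fun s => ?_⟩
  have h := Measure.isAddLeftInvariant_eq_smul (Measure.map e (volume : Measure (RProd m n)))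
    (volume : Measure (Fin m → RSpace n))
  have h2 : volume s = Measure.map e (volume : Measure (RProd m n))
      ((fun w : Fin m → RSpace n => (WithLp.toLp 2 w : RProd m n)) ⁻¹' s) := by
    rw [show (e : RProd m n → (Fin m → RSpace n)) = e.toHomeomorph.toMeasurableEquiv from rfl,
      MeasurableEquiv.map_apply]
    rfl
  rw [h2]
  conv_lhs => rw [h]
  rfl

/-- Neighbourhoods of the partial diagonal in the sphere have measure `O(δ^{n|S|})`. -/
lemma exists_surfaceMeasure_diagGap_le (m : ℕ) {n : ℕ} (hn : 1 ≤ n) {S : Finset (Fin m)}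
    {k : Fin m} (hk : k ∉ S) : ∃ C : ENNReal, C ≠ ⊤ ∧ ∀ δ : ℝ, 0 ≤ δ →
      surfaceMeasure m n {θ | diagGap S k (θ : RProd m n).ofLp ≤ δ} ≤
        C * ENNReal.ofReal (δ ^ (n * S.card)) := by
  obtain ⟨c, hc, h⟩ := exists_volume_toLp_le m n
  refine ⟨Module.finrank ℝ (RProd m n) * (c * volume (Metric.closedBall (0 : RSpace n) 1) ^ m),
    ENNReal.mul_ne_top (by simp) (ENNReal.mul_ne_top hc
      (ENNReal.pow_ne_top measure_closedBall_lt_top.ne)), fun δ hδ => ?_⟩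
  have hms : MeasurableSet {θ : USphere m n | diagGap S k (θ : RProd m n).ofLp ≤ δ} := by
    refine IsClosed.measurableSet (isClosed_le ?_ continuous_const)
    exact (continuous_diagGap S k).comp ((PiLp.continuous_ofLp 2 _).comp continuous_subtype_val)
  rw [surfaceMeasure, Measure.toSphere_apply' _ hms, mul_assoc, mul_assoc]
  gcongr
  refine (h _).trans ?_
  gcongr
  refine le_trans (measure_mono ?_) (volume_diagGap_le hn hk hδ)
  -- The surface measure is a multiple of the volume of the cone of points `r • θ`, `0 < r < 1`; the
  -- gap is homogeneous, so it stays at most `δ` on that cone.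
  rintro w ⟨r, ⟨hr0, hr1⟩, _, ⟨θ, hθ, rfl⟩, hw⟩
  have hw' : w = r • (θ : RProd m n).ofLp := by
    have := congrArg WithLp.ofLp hw
    simpa using this.symm
  have hθ1 : ‖(θ : RProd m n)‖ = 1 := by simp
  subst hw'
  refine ⟨fun i => ?_, ?_⟩
  · have := PiLp.norm_apply_le (θ : RProd m n) i
    rw [hθ1] at this
    rw [Pi.smul_apply, norm_smul, Real.norm_of_nonneg hr0.le]
    nlinarith [norm_nonneg ((θ : RProd m n).ofLp i)]
  · rw [diagGap_smul, abs_of_pos hr0]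
    have : diagGap S k (θ : RProd m n).ofLp ≤ δ := hθ
    nlinarith [diagGap_nonneg S k (θ : RProd m n).ofLp]

/-! ### Principal values without cancellation -/

lemma EReal.abs_coe_ennreal (x : ENNReal) : (x : EReal).abs = x := by
  induction x with
  | top => rfl
  | coe x =>
    change ((x : ℝ) : EReal).abs = _
    rw [EReal.abs_def, NNReal.abs_eq, ENNReal.ofReal_coe_nnreal]

/-- For an integrand that is nonnegative and vanishes near the singularity, the principal value is
the Lebesgue integral. -/
lemma roughT_eq_lintegral {m n : ℕ} {Ω : USphere m n → ℝ} {f : Fin m → RSpace n → ℝ}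
    {x : RSpace n}
    (hm : Measurable fun y : Fin m → RSpace n => roughKernel Ω (diagSub x y) * ∏ i, f i (y i))
    (h0 : ∀ y : Fin m → RSpace n, 0 ≤ roughKernel Ω (diagSub x y) * ∏ i, f i (y i))
    {r : ℝ} (hr : 0 < r)
    (hs : ∀ y : Fin m → RSpace n, ‖diagSub x y‖ ≤ r → ∏ i, f i (y i) = 0) :
    roughT Ω f x = ((∫⁻ y : Fin m → RSpace n,
      ENNReal.ofReal (roughKernel Ω (diagSub x y) * ∏ i, f i (y i)) : ENNReal) : EReal) := by
  set h : (Fin m → RSpace n) → ℝ := fun y => roughKernel Ω (diagSub x y) * ∏ i, f i (y i) with hh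
  set J : ℝ → ENNReal := fun ε =>
    ∫⁻ y in {y : Fin m → RSpace n | ε < ‖diagSub x y‖}, ENNReal.ofReal (h y) with hJ
  have hneg : ∀ y, ENNReal.ofReal (-h y) = 0 := fun y =>
    ENNReal.ofReal_of_nonpos (by linarith [h0 y])
  have hval : ∀ ε v, HasExtIntegral (volume.restrict {y : Fin m → RSpace n | ε < ‖diagSub x y‖})
      h v ↔ v = (J ε : EReal) := by
    intro ε v
    simp only [HasExtIntegral, hneg, lintegral_zero, hJ]
    constructor
    · rintro ⟨-, -, h3⟩
      simpa using h3
    · intro h3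
      exact ⟨hm.aemeasurable, Or.inr (by simp), by simpa using h3⟩
  -- Once `ε < r`, the truncation removes only points where the integrand vanishes.
  have hJc : ∀ ε ∈ Set.Ioo 0 r, J ε = ∫⁻ y, ENNReal.ofReal (h y) := by
    intro ε hε
    refine setLIntegral_eq_of_support_subset ?_
    intro y hy
    by_contra hc
    have hc' : ‖diagSub x y‖ ≤ ε := not_lt.1 hc
    apply hy
    simp [hh, hs y (hc'.trans hε.2.le)]
  have hlim : Tendsto (fun ε => (J ε : EReal)) (𝓝[>] 0)
      (𝓝 ((∫⁻ y, ENNReal.ofReal (h y) : ENNReal) : EReal)) := by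
    refine tendsto_const_nhds.congr' ?_
    filter_upwards [Ioo_mem_nhdsGT hr] with ε hε
    rw [hJc ε hε]
  have hiff : ∀ v, HasPrincipalValue Ω f x v →
      v = ((∫⁻ y, ENNReal.ofReal (h y) : ENNReal) : EReal) := by
    rintro v ⟨I, hI, hv⟩
    refine tendsto_nhds_unique hv (hlim.congr' ?_)
    filter_upwards [self_mem_nhdsWithin] with ε hε
    exact ((hval ε _).1 (hI ε hε)).symm
  have hex : ∃ v, HasPrincipalValue Ω f x v :=
    ⟨_, fun ε => (J ε : EReal), fun ε _ => (hval ε _).2 rfl, hlim⟩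
  rw [roughT, dif_pos hex]
  exact hiff _ hex.choose_spec

/-! ### The odd angular function -/

lemma Real.measurable_sign : Measurable Real.sign := by
  unfold Real.sign
  exact Measurable.ite measurableSet_Iio measurable_const
    (Measurable.ite measurableSet_Ioi measurable_const measurable_const)

lemma Real.abs_sign_le_one (t : ℝ) : |Real.sign t| ≤ 1 := by
  rcases Real.sign_apply_eq t with h | h | h <;> simp [h]

/-- An odd function with a singularity along the partial diagonal `w_i = w_k`, `i ∈ S`. -/
noncomputable def diagSingular {m n : ℕ} (S : Finset (Fin m)) (k : Fin m) (e : Fin n) (s : ℝ)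
    (w : RProd m n) : ℝ :=
  Real.sign (w k e) * dyadicWeight (-s) 1 (dyadicIndex (diagGap S k w.ofLp)⁻¹)

lemma measurable_ofLp_prod (m n : ℕ) : Measurable fun w : RProd m n => w.ofLp :=
  (PiLp.continuous_ofLp 2 _).measurable

lemma measurable_dyadicIndex_diagGap {m n : ℕ} (S : Finset (Fin m)) (k : Fin m) :
    Measurable fun w : RProd m n => dyadicIndex (diagGap S k w.ofLp)⁻¹ :=
  measurable_dyadicIndex.comp
    (((continuous_diagGap S k).measurable.comp (measurable_ofLp_prod m n)).inv)

lemma measurable_diagSingular {m n : ℕ} (S : Finset (Fin m)) (k : Fin m) (e : Fin n) (s : ℝ) :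
    Measurable (diagSingular S k e s) := by
  refine Measurable.mul (Real.measurable_sign.comp ?_)
    ((measurable_from_top (f := dyadicWeight (-s) 1)).comp (measurable_dyadicIndex_diagGap S k))
  exact Continuous.measurable (by fun_prop)

lemma diagSingular_neg {m n : ℕ} (S : Finset (Fin m)) (k : Fin m) (e : Fin n) (s : ℝ)
    (w : RProd m n) : diagSingular S k e s (-w) = -diagSingular S k e s w := by
  have h : diagGap S k (-w).ofLp = diagGap S k w.ofLp := by
    have := diagGap_smul S k (-1) w.ofLp
    simpa using this
  rw [diagSingular, h]
  simp [diagSingular, Real.sign_neg]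

/-- The level at distance about `2^{-j}` has measure `O(2^{-jn|S|})`, which cancels the `q`-th power
of `2^{jn|S|/q}`. What remains is `∑ (j + 1)^{-q}`, convergent because `q > 1`. -/
lemma memLp_diagSingular {m n : ℕ} (hn : 1 ≤ n) {S : Finset (Fin m)} {k : Fin m} (hk : k ∉ S)
    (e : Fin n) {q : ℝ} (hq : 1 < q) :
    MemLp (fun θ : USphere m n => diagSingular S k e (n * S.card / q) θ) (ENNReal.ofReal q)
      (surfaceMeasure m n) := by
  obtain ⟨C, hC, h⟩ := exists_surfaceMeasure_diagGap_le m hn hk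
  have hfin : surfaceMeasure m n Set.univ ≠ ⊤ := by
    unfold surfaceMeasure
    exact measure_ne_top _ _
  have hmem := memLp_dyadicWeight_comp (μ := surfaceMeasure m n)
    (g := fun θ : USphere m n => dyadicIndex (diagGap S k (θ : RProd m n).ofLp)⁻¹)
    ((measurable_dyadicIndex_diagGap S k).comp measurable_subtype_coe)
    (s := -(n * S.card)) (a := 1) (r := q) (by linarith) (by linarith)
    (C := C + surfaceMeasure m n Set.univ) (ENNReal.add_ne_top.2 ⟨hC, hfin⟩) (fun j => ?_)
  · refine hmem.mono ((measurable_diagSingular S k e _).comp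
      measurable_subtype_coe).aestronglyMeasurable (ae_of_all _ fun θ => ?_)
    rw [diagSingular, norm_mul, neg_div]
    exact mul_le_of_le_one_left (norm_nonneg _) (Real.abs_sign_le_one _)
  -- Level `0` gathers all points far from the diagonal, and also the diagonal itself since `0⁻¹ =
  -- 0`; it is bounded by the total mass.
  · rcases Nat.eq_zero_or_pos j with rfl | hj
    · simp only [CharP.cast_eq_zero, mul_zero, Real.rpow_zero, ENNReal.ofReal_one, mul_one]
      exact (measure_mono (Set.subset_univ _)).trans le_add_self
    · calc _ ≤ surfaceMeasure m n {θ | diagGap S k (θ : RProd m n).ofLp ≤ ((2 : ℝ) ^ j)⁻¹} := by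
            refine measure_mono fun θ hθ => ?_
            simp only [Set.mem_preimage, Set.mem_singleton_iff] at hθ
            have := two_pow_dyadicIndex_le (hθ.symm ▸ hj.ne')
            rw [hθ] at this
            exact le_inv_of_le_inv₀ (by positivity) this
        _ ≤ C * ENNReal.ofReal (((2 : ℝ) ^ j)⁻¹ ^ (n * S.card)) := h _ (by positivity)
        _ = C * ENNReal.ofReal ((2 : ℝ) ^ (-((n : ℝ) * S.card) * j)) := by
            congr 2
            rw [neg_mul, Real.rpow_neg (by norm_num), inv_pow, ← pow_mul, mul_comm j,
              ← Real.rpow_natCast]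
            push_cast
            rfl
        _ ≤ _ := by gcongr; exact le_self_add

/-- Extending the angular function to the whole space removes the dependent sphere point, so
measurability can be checked by composition. -/
lemma roughKernel_restrict {m n : ℕ} (Φ : RProd m n → ℝ) (w : RProd m n) :
    roughKernel (fun θ : USphere m n => Φ θ) w =
      if w = 0 then 0 else Φ (‖w‖⁻¹ • w) / ‖w‖ ^ (m * n) := by
  unfold roughKernel
  by_cases h : w = 0 <;> simp [h]

lemma measurable_roughKernel_restrict {m n : ℕ} {Φ : RProd m n → ℝ} (hΦ : Measurable Φ) :
    Measurable (roughKernel (fun θ : USphere m n => Φ θ)) := by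
  simp_rw [funext (roughKernel_restrict Φ)]
  refine Measurable.ite (measurableSet_singleton 0) measurable_const ?_
  exact (hΦ.comp (measurable_norm.inv.smul measurable_id)).div (measurable_norm.pow_const _)

lemma measurable_diagSub {m n : ℕ} (x : RSpace n) :
    Measurable fun y : Fin m → RSpace n => diagSub x y := by
  refine ((PiLp.continuous_toLp 2 _).comp ?_).measurable
  exact continuous_pi fun i => by fun_prop

/-! ### Arithmetic of dyadic weights -/

lemma dyadicWeight_mul (s a s' a' : ℝ) (j : ℕ) :
    dyadicWeight s a j * dyadicWeight s' a' j = dyadicWeight (s + s') (a + a') j := by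
  unfold dyadicWeight
  rw [mul_mul_mul_comm, ← Real.rpow_add (by norm_num), ← Real.rpow_add (by positivity)]
  ring_nf

lemma dyadicWeight_zero (j : ℕ) : dyadicWeight 0 0 j = 1 := by simp [dyadicWeight]

lemma prod_dyadicWeight {ι : Type*} (T : Finset ι) (s a : ι → ℝ) (j : ℕ) :
    ∏ i ∈ T, dyadicWeight (s i) (a i) j = dyadicWeight (∑ i ∈ T, s i) (∑ i ∈ T, a i) j := by
  classical
  induction T using Finset.induction_on with
  | empty => simp [dyadicWeight_zero]
  | insert i T hi ih => rw [Finset.prod_insert hi, Finset.sum_insert hi, Finset.sum_insert hi, ih,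
      dyadicWeight_mul]

lemma dyadicWeight_le_dyadicWeight {s a s' a' : ℝ} (hs : s' ≤ s) (ha : a' ≤ a) (j : ℕ) :
    dyadicWeight s a j ≤ dyadicWeight s' a' j := by
  have hj : (0 : ℝ) ≤ j := Nat.cast_nonneg j
  unfold dyadicWeight
  gcongr
  · norm_num
  · linarith

lemma two_pow_eq_dyadicWeight (d j : ℕ) : ((2 : ℝ) ^ j) ^ d = dyadicWeight (-d) 0 j := by
  simp only [dyadicWeight, neg_zero, Real.rpow_zero, mul_one, neg_mul, neg_neg]
  rw [mul_comm, Real.rpow_mul (by norm_num), Real.rpow_natCast, Real.rpow_natCast]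

/-- With a growing power and a decaying logarithm the weight is not monotone: the power needs `j`
not much below `L`, the logarithmic factor needs `j` not much above it. -/
lemma dyadicWeight_neg_ge {s : ℝ} (hs : 0 ≤ s) {L l j : ℕ} (h1 : L ≤ j + 2) (h2 : j ≤ L + l) :
    (2 : ℝ) ^ (-(2 * s)) / (l + 1) * dyadicWeight (-s) 1 L ≤ dyadicWeight (-s) 1 j := by
  have h1' : (L : ℝ) ≤ j + 2 := by exact_mod_cast h1
  have h2' : (j : ℝ) ≤ L + l := by exact_mod_cast h2
  have hL : (0 : ℝ) ≤ L := Nat.cast_nonneg L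
  have hl : (0 : ℝ) ≤ l := Nat.cast_nonneg l
  unfold dyadicWeight
  rw [Real.rpow_neg_one, Real.rpow_neg_one]
  calc _ = (2 : ℝ) ^ (-(2 * s) + -(-s * L)) * ((l + 1) * (L + 1) : ℝ)⁻¹ := by
        rw [Real.rpow_add (by norm_num)]
        field_simp
    _ ≤ _ := by
        gcongr
        · norm_num
        · nlinarith
        · nlinarith

/-! ### Divergence over far balls -/

/-- The divergence criterion: lower bounds `2^{-Ln/p} (L + 1)^{-1/p}` on disjoint sets of measure
comparable to `2^{Ln}`. -/
lemma lintegral_rpow_eq_top_of_dyadicWeight_le {X : Type*} [MeasurableSpace X] {μ : Measure X}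
    {g : X → ENNReal} {p s c v : ℝ} (hp : 0 < p) (hc : 0 < c) (hv : 0 < v) {E : ℕ → Set X}
    (hE : ∀ j, MeasurableSet (E j)) (hd : Pairwise (Function.onFun Disjoint E)) {L₀ : ℕ}
    (hμ : ∀ L, L₀ ≤ L → μ (E L) = ENNReal.ofReal (v * (2 : ℝ) ^ (s * L)))
    (hg : ∀ L, L₀ ≤ L → ∀ x ∈ E L,
      ENNReal.ofReal (c * dyadicWeight (s / p) (1 / p) L) ≤ g x) :
    ∫⁻ x, g x ^ p ∂μ = ⊤ := by
  have key : ∀ L, L₀ ≤ L →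
      ENNReal.ofReal (c ^ p * v * ((L : ℝ) + 1)⁻¹) ≤ ∫⁻ x in E L, g x ^ p ∂μ := by
    intro L hL
    have hw := dyadicWeight_pos (s / p) (1 / p) L
    calc _ = ENNReal.ofReal (c * dyadicWeight (s / p) (1 / p) L) ^ p * μ (E L) := by
          rw [hμ L hL, ENNReal.ofReal_rpow_of_pos (by positivity),
            ← ENNReal.ofReal_mul (by positivity), Real.mul_rpow hc.le hw.le, dyadicWeight_rpow,
            div_mul_cancel₀ _ hp.ne', div_mul_cancel₀ _ hp.ne', ← Real.rpow_neg_one,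
            ← dyadicWeight_mul_two_rpow s 1 L]
          congr 1
          ring
      _ = ∫⁻ _ in E L, ENNReal.ofReal (c * dyadicWeight (s / p) (1 / p) L) ^ p ∂μ := by
          rw [setLIntegral_const]
      _ ≤ _ := by
          refine setLIntegral_mono' (hE L) fun x hx => ?_
          exact ENNReal.rpow_le_rpow (hg L hL x hx) hp.le
  have hns : ¬ Summable fun j : ℕ => c ^ p * v * (((j + L₀ : ℕ) : ℝ) + 1)⁻¹ := by
    rw [summable_mul_left_iff (by positivity)]
    have h1 := mt (summable_nat_add_iff (f := fun n : ℕ => 1 / (n : ℝ)) (L₀ + 1)).mp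
      Real.not_summable_one_div_natCast
    convert! h1 using 3 with j
    push_cast
    rw [one_div]
    congr 1
    ring
  rw [eq_top_iff]
  calc (⊤ : ENNReal) = ∑' j : ℕ, ENNReal.ofReal (c ^ p * v * (((j + L₀ : ℕ) : ℝ) + 1)⁻¹) := by
        by_contra hne
        apply hns
        have := ENNReal.summable_toReal (Ne.symm hne)
        refine this.congr fun j => ?_
        rw [ENNReal.toReal_ofReal (by positivity)]
    _ ≤ ∑' j : ℕ, ∫⁻ x in E (j + L₀), g x ^ p ∂μ :=
        ENNReal.tsum_le_tsum fun j => key _ (by omega)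
    _ = ∫⁻ x in ⋃ j, E (j + L₀), g x ^ p ∂μ := by
        rw [lintegral_iUnion (fun j => hE _)]
        exact fun i j hij => hd (by omega)
    _ ≤ _ := setLIntegral_le_lintegral _ _

/-- The ball of radius `2^L` about `4 · 2^L e`. -/
noncomputable def farBall {n : ℕ} (e : Fin n) (L : ℕ) : Set (RSpace n) :=
  Metric.ball (EuclideanSpace.single e (4 * 2 ^ L : ℝ)) (2 ^ L)

lemma norm_bounds_of_mem_farBall {n : ℕ} {e : Fin n} {L : ℕ} {x : RSpace n}
    (hx : x ∈ farBall e L) : 3 * 2 ^ L < x e ∧ 3 * 2 ^ L < ‖x‖ ∧ ‖x‖ < 5 * 2 ^ L := by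
  rw [farBall, mem_ball_iff_norm] at hx
  have h1 := (PiLp.norm_apply_le (x - EuclideanSpace.single e (4 * 2 ^ L : ℝ)) e).trans_lt hx
  have h2 : ‖EuclideanSpace.single e (4 * 2 ^ L : ℝ)‖ = 4 * 2 ^ L := by
    simp
  have h3 := norm_sub_norm_le x (EuclideanSpace.single e (4 * 2 ^ L : ℝ))
  have h4 := norm_sub_norm_le (EuclideanSpace.single e (4 * 2 ^ L : ℝ)) x
  rw [norm_sub_rev] at h4
  rw [h2] at h3 h4
  have h5 : |x e - 4 * 2 ^ L| < 2 ^ L := by simpa using h1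
  have := abs_lt.1 h5
  refine ⟨?_, ?_, ?_⟩ <;> linarith

/-- Norms in the ball of index `L` lie between `3 * 2^L` and `5 * 2^L`, and `5 * 2^i < 3 * 2^j` when
`i < j`. -/
lemma pairwise_disjoint_farBall {n : ℕ} (e : Fin n) :
    Pairwise (Function.onFun Disjoint (farBall e)) := by
  have h : ∀ i j, i < j → Disjoint (farBall e i) (farBall e j) := by
    intro i j hij
    rw [Set.disjoint_left]
    intro x hi hj
    have h1 := (norm_bounds_of_mem_farBall hi).2.2
    have h2 := (norm_bounds_of_mem_farBall hj).2.1
    have h3 : (2 : ℝ) ^ (i + 1) ≤ 2 ^ j := pow_le_pow_right₀ (by norm_num) hij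
    rw [pow_succ] at h3
    have : (0 : ℝ) < 2 ^ i := by positivity
    linarith
  intro i j hij
  rcases lt_or_gt_of_ne hij with h' | h'
  · exact h i j h'
  · exact (h j i h').symm

/-! ### Lower bound for the kernel -/

lemma norm_le_mul_of_forall {m n : ℕ} (w : RProd m n) {r : ℝ} (hr : 0 ≤ r)
    (h : ∀ i, ‖w i‖ ≤ r) : ‖w‖ ≤ m * r := by
  have h2 : ‖w‖ ^ 2 ≤ (m * r) ^ 2 := by
    rw [PiLp.norm_sq_eq_of_L2]
    calc _ ≤ ∑ _i : Fin m, r ^ 2 := by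
          refine Finset.sum_le_sum fun i _ => ?_
          exact pow_le_pow_left₀ (norm_nonneg _) (h i) 2
      _ = m * r ^ 2 := by simp
      _ ≤ _ := by
          rw [mul_pow]
          gcongr
          rcases Nat.eq_zero_or_pos m with rfl | hm
          · simp
          · have : (1 : ℝ) ≤ m := by exact_mod_cast hm
            nlinarith
  exact (pow_le_pow_iff_left₀ (norm_nonneg _) (by positivity) (by norm_num)).1 h2

/-- The kernel is large when `x` is far from a cluster of points `y_i`, `i ∈ S ∪ {k}`, and the other
points are at distance at most comparable to that of `x`. -/
lemma le_roughKernel_diagSingular {m n : ℕ} {S : Finset (Fin m)} (hS : S.Nonempty) {k : Fin m}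
    (e : Fin n) {s : ℝ} (hs : 0 ≤ s) {L : ℕ} (hL : 3 ≤ L) {x : RSpace n} (hx : x ∈ farBall e L)
    {y : Fin m → RSpace n} (hyk : y k ∈ Metric.ball (0 : RSpace n) 1)
    (hyS : ∀ i ∈ S, y i ∈ Metric.ball (EuclideanSpace.single e (4 : ℝ)) 1)
    (hy : ∀ i, ‖y i‖ ≤ 2 ^ L) :
    (2 : ℝ) ^ (-(2 * s)) / ((m + 2 : ℕ) + 1) / (6 * m) ^ (m * n) *
        dyadicWeight (-s + (m * n : ℕ)) 1 L ≤
      roughKernel (fun θ : USphere m n => diagSingular S k e s θ) (diagSub x y) := by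
  obtain ⟨hx1, hx2, hx3⟩ := norm_bounds_of_mem_farBall hx
  have hR : (8 : ℝ) ≤ 2 ^ L := by
    calc (8 : ℝ) = 2 ^ 3 := by norm_num
      _ ≤ 2 ^ L := pow_le_pow_right₀ (by norm_num) hL
  set R : ℝ := 2 ^ L with hRdef
  set w : RProd m n := diagSub x y with hw
  have hwi : ∀ i, w i = x - y i := fun i => rfl
  have hyk' : ‖y k‖ < 1 := by simpa using hyk
  have hm : 1 ≤ m := by have := k.2; omega
  have hm' : (1 : ℝ) ≤ m := by exact_mod_cast hm
  have hwn1 : 2 * R ≤ ‖w‖ := by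
    have h1 := PiLp.norm_apply_le w k
    have h2 := norm_sub_norm_le x (y k)
    rw [hwi] at h1
    linarith
  have hwn2 : ‖w‖ ≤ m * (6 * R) := by
    refine norm_le_mul_of_forall w (by positivity) fun i => ?_
    rw [hwi]
    have := norm_sub_le x (y i)
    linarith [hy i]
  have hwpos : 0 < ‖w‖ := by linarith
  -- The centres `0` and `4e` keep the two clusters apart. The lower bound on the gap matters too:
  -- too close to the diagonal, the logarithmic factor would be uncontrolled.
  have hgap : ∀ i ∈ S, 2 ≤ ‖w i - w k‖ ∧ ‖w i - w k‖ ≤ 6 := by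
    intro i hi
    have h1 : ‖y i - EuclideanSpace.single e (4 : ℝ)‖ < 1 := by
      simpa [dist_eq_norm] using hyS i hi
    have h2 : ‖EuclideanSpace.single e (4 : ℝ)‖ = 4 := by simp
    have h3 : w i - w k = y k - y i := by rw [hwi, hwi]; abel
    have h4 := norm_sub_norm_le (EuclideanSpace.single e (4 : ℝ)) (y i)
    have h5 := norm_sub_norm_le (y i) (EuclideanSpace.single e (4 : ℝ))
    have h6 := norm_sub_norm_le (y i) (y k)
    have h7 := norm_sub_le (y k) (y i)
    rw [norm_sub_rev] at h4 h6
    rw [h3]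
    constructor <;> linarith
  have hd2 : diagGap S k w.ofLp ≤ 6 := diagGap_le (by norm_num) fun i hi => (hgap i hi).2
  have hd1 : 2 ≤ diagGap S k w.ofLp := by
    obtain ⟨i, hi⟩ := hS
    exact (hgap i hi).1.trans (norm_sub_le_diagGap k w.ofLp hi)
  have hdθ : (diagGap S k (‖w‖⁻¹ • w).ofLp)⁻¹ = ‖w‖ / diagGap S k w.ofLp := by
    rw [WithLp.ofLp_smul, diagGap_smul, abs_of_pos (by positivity), mul_inv, inv_inv]
    rfl
  -- The ratio is at least `2R / 6`, hence at least `R / 4 = 2^{L-2}`.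
  have hj1 : L - 2 ≤ dyadicIndex (diagGap S k (‖w‖⁻¹ • w).ofLp)⁻¹ := by
    apply le_dyadicIndex
    rw [hdθ, le_div_iff₀ (by linarith)]
    have h4 : (2 : ℝ) ^ (L - 2) * 4 = R := by
      rw [show (4 : ℝ) = 2 ^ 2 by norm_num, ← pow_add, hRdef]
      congr 1
      omega
    have : (0 : ℝ) < 2 ^ (L - 2) := by positivity
    nlinarith
  -- The ratio is at most `6mR / 2`, and `3m < 2^{m+3}`.
  have hj2 : dyadicIndex (diagGap S k (‖w‖⁻¹ • w).ofLp)⁻¹ ≤ L + (m + 2) := by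
    apply dyadicIndex_le
    rw [hdθ, div_lt_iff₀ (by linarith)]
    have h4 : (2 : ℝ) ^ (L + (m + 2) + 1) = R * (2 ^ m * 8) := by
      rw [pow_add, pow_add, pow_add, hRdef]
      ring
    have h5 : (m : ℝ) ≤ 2 ^ m := by exact_mod_cast (Nat.lt_two_pow_self (n := m)).le
    rw [h4]
    have h6 : m * (6 * R) < R * (2 ^ m * 8) * 2 := by nlinarith
    have h7 : 0 ≤ R * (2 ^ m * 8) := by positivity
    nlinarith
  have hsign : Real.sign ((‖w‖⁻¹ • w) k e) = 1 := by
    apply Real.sign_of_pos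
    have h1 := (PiLp.norm_apply_le (y k) e).trans_lt hyk'
    rw [Real.norm_eq_abs, abs_lt] at h1
    have h2 : (‖w‖⁻¹ • w) k e = ‖w‖⁻¹ * (x e - y k e) := rfl
    rw [h2]
    have : 0 < x e - y k e := by linarith
    positivity
  rw [roughKernel_restrict, if_neg (by simpa using hwpos), diagSingular, hsign, one_mul]
  have h1 := dyadicWeight_neg_ge hs (L := L) (l := m + 2)
    (j := dyadicIndex (diagGap S k (‖w‖⁻¹ • w).ofLp)⁻¹) (by omega) (by omega)
  have h2 : ‖w‖ ^ (m * n) ≤ (6 * m) ^ (m * n) * dyadicWeight (-(m * n : ℕ)) 0 L := by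
    rw [← two_pow_eq_dyadicWeight, ← mul_pow]
    refine pow_le_pow_left₀ hwpos.le (hwn2.trans_eq (by ring)) _
  rw [le_div_iff₀ (by positivity)]
  refine le_trans ?_ h1
  have hw0 := dyadicWeight_pos (-s + (m * n : ℕ)) 1 L
  calc _ ≤ (2 : ℝ) ^ (-(2 * s)) / ((m + 2 : ℕ) + 1) / (6 * m) ^ (m * n) *
        dyadicWeight (-s + (m * n : ℕ)) 1 L *
          ((6 * m) ^ (m * n) * dyadicWeight (-(m * n : ℕ)) 0 L) := by gcongr
    _ = (2 : ℝ) ^ (-(2 * s)) / ((m + 2 : ℕ) + 1) *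
        (dyadicWeight (-s + (m * n : ℕ)) 1 L * dyadicWeight (-(m * n : ℕ)) 0 L) := by
        field_simp
    _ = _ := by
        rw [dyadicWeight_mul]
        congr 2 <;> ring

/-! ### Test functions and the lower bound for the operator -/

/-- The test functions: indicators of two unit balls for the clustered indices, and slowly
decaying radial functions for the others. -/
noncomputable def testFun {m n : ℕ} (S : Finset (Fin m)) (k : Fin m) (e : Fin n)
    (ps a : Fin m → ℝ) (i : Fin m) : RSpace n → ℝ :=
  if i = k then (Metric.ball 0 1).indicator 1
  else if i ∈ S then (Metric.ball (EuclideanSpace.single e (4 : ℝ)) 1).indicator 1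
  else fun y => dyadicWeight (n / ps i) (a i) (dyadicIndex ‖y‖)

lemma measurable_testFun {m n : ℕ} (S : Finset (Fin m)) (k : Fin m) (e : Fin n)
    (ps a : Fin m → ℝ) (i : Fin m) : Measurable (testFun S k e ps a i) := by
  unfold testFun
  split_ifs
  · exact measurable_one.indicator measurableSet_ball
  · exact measurable_one.indicator measurableSet_ball
  · exact (measurable_from_top (f := dyadicWeight (n / ps i) (a i))).comp
      (measurable_dyadicIndex.comp measurable_norm)

lemma testFun_nonneg {m n : ℕ} (S : Finset (Fin m)) (k : Fin m) (e : Fin n)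
    (ps a : Fin m → ℝ) (i : Fin m) (y : RSpace n) : 0 ≤ testFun S k e ps a i y := by
  unfold testFun
  split_ifs
  · exact Set.indicator_nonneg (fun _ _ => zero_le_one) _
  · exact Set.indicator_nonneg (fun _ _ => zero_le_one) _
  · exact (dyadicWeight_pos _ _ _).le

lemma memLp_testFun {m n : ℕ} (hn : 1 ≤ n) (S : Finset (Fin m)) (k : Fin m) (e : Fin n)
    {ps a : Fin m → ℝ} {i : Fin m} (hps : 0 < ps i) (ha : 1 < a i * ps i) :
    MemLp (testFun S k e ps a i) (ENNReal.ofReal (ps i)) volume := by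
  unfold testFun
  split_ifs
  · exact memLp_indicator_const _ measurableSet_ball (1 : ℝ) (Or.inr measure_ball_lt_top.ne)
  · exact memLp_indicator_const _ measurableSet_ball (1 : ℝ) (Or.inr measure_ball_lt_top.ne)
  · exact memLp_dyadicWeight_norm hn hps ha

lemma prod_testFun_eq_zero {m n : ℕ} {S : Finset (Fin m)} {k : Fin m} {e : Fin n}
    {ps a : Fin m → ℝ} {y : Fin m → RSpace n} (hy : 1 ≤ ‖y k‖) :
    ∏ i, testFun S k e ps a i (y i) = 0 := by
  refine Finset.prod_eq_zero (Finset.mem_univ k) ?_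
  simp [testFun, hy]

/-- On the support of `f_k` one has `|y_k| < 1`, so `x e > 2` makes the coordinate of `x - y_k`
exceed `1`. This fixes the sign of the kernel and keeps the support away from the singularity. -/
lemma roughT_testFun {m n : ℕ} (S : Finset (Fin m)) (k : Fin m) (e : Fin n)
    (ps a : Fin m → ℝ) (s : ℝ) {x : RSpace n} (hx : 2 < x e) :
    (roughT (fun θ : USphere m n => diagSingular S k e s θ) (testFun S k e ps a) x).abs =
      ∫⁻ y : Fin m → RSpace n, ENNReal.ofReal
        (roughKernel (fun θ : USphere m n => diagSingular S k e s θ) (diagSub x y) *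
          ∏ i, testFun S k e ps a i (y i)) := by
  have hpos : ∀ y : RSpace n, ‖y‖ < 1 → 1 < (x - y) e := by
    intro y hy
    have h1 := (PiLp.norm_apply_le y e).trans_lt hy
    rw [Real.norm_eq_abs, abs_lt] at h1
    rw [PiLp.sub_apply]
    linarith
  rw [roughT_eq_lintegral (r := 1) ?_ ?_ one_pos ?_, EReal.abs_coe_ennreal]
  · refine ((measurable_roughKernel_restrict (measurable_diagSingular S k e s)).comp
      (measurable_diagSub x)).mul (Finset.measurable_prod _ fun i _ => ?_)
    exact (measurable_testFun S k e ps a i).comp (measurable_pi_apply i)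
  · intro y
    rcases le_or_gt 1 ‖y k‖ with h | h
    · simp [prod_testFun_eq_zero h]
    · refine mul_nonneg ?_ (Finset.prod_nonneg fun i _ => testFun_nonneg _ _ _ _ _ _ _)
      rw [roughKernel_restrict]
      split_ifs with hw
      · exact le_rfl
      · refine div_nonneg (mul_nonneg ?_ (dyadicWeight_pos _ _ _).le) (by positivity)
        have h2 : (‖diagSub x y‖⁻¹ • diagSub x y) k e = ‖diagSub x y‖⁻¹ * (x - y k) e := rfl
        have h3 := hpos _ h
        have h4 : 0 < ‖diagSub x y‖ := norm_pos_iff.2 hw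
        rw [h2, Real.sign_of_pos (by positivity)]
        exact zero_le_one
  · intro y hy
    refine prod_testFun_eq_zero (not_lt.1 fun h => ?_)
    have h1 := hpos _ h
    have h2 : ‖x - y k‖ ≤ ‖diagSub x y‖ := PiLp.norm_apply_le (diagSub x y) k
    have h3 := (le_abs_self _).trans (PiLp.norm_apply_le (x - y k) e)
    linarith

lemma volume_ball_eq_dyadicWeight {n : ℕ} (hn : 1 ≤ n) (z : RSpace n) (L : ℕ) :
    volume (Metric.ball z (2 ^ L)) =
      ENNReal.ofReal (volume.real (Metric.ball (0 : RSpace n) 1) * dyadicWeight (-n) 0 L) := by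
  have : Nonempty (Fin n) := ⟨⟨0, hn⟩⟩
  rw [Measure.addHaar_ball _ _ (by positivity), finrank_euclideanSpace_fin,
    two_pow_eq_dyadicWeight, mul_comm (volume.real _), ENNReal.ofReal_mul (dyadicWeight_pos _ _ _).le,
    ofReal_measureReal measure_ball_lt_top.ne]

/-- The lower bound for the operator on the far balls. -/
lemma exists_le_roughT_testFun {m n : ℕ} (hn : 1 ≤ n) {S : Finset (Fin m)} (hS : S.Nonempty)
    {k : Fin m} (hk : k ∉ S) (e : Fin n) {ps a : Fin m → ℝ} (hps : ∀ i, 0 < ps i) (ha : ∀ i, 0 ≤ a i)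
    {s : ℝ} (hs : 0 ≤ s) {τ σ : ℝ}
    (hσ : -s + n * (insert k S).card + ∑ i ∈ (insert k S)ᶜ, n / ps i ≤ σ)
    (hτ : 1 + ∑ i ∈ (insert k S)ᶜ, a i ≤ τ) :
    ∃ c : ℝ, 0 < c ∧ ∀ L, 3 ≤ L → ∀ x ∈ farBall e L,
      ENNReal.ofReal (c * dyadicWeight σ τ L) ≤
        (roughT (fun θ : USphere m n => diagSingular S k e s θ) (testFun S k e ps a) x).abs := by
  have : Nonempty (Fin n) := ⟨e⟩
  set v := volume.real (Metric.ball (0 : RSpace n) 1) with hv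
  have hv0 : 0 < v := ENNReal.toReal_pos (Metric.measure_ball_pos _ _ one_pos).ne'
    measure_ball_lt_top.ne
  have hm : (0 : ℝ) < m := by exact_mod_cast (Nat.zero_le _).trans_lt k.2
  set A := insert k S with hA
  set c₁ : ℝ := (2 : ℝ) ^ (-(2 * s)) / ((m + 2 : ℕ) + 1) / (6 * m) ^ (m * n) with hc₁
  refine ⟨c₁ * v ^ m, by positivity, fun L hL x hx => ?_⟩
  -- The points near `4e` have norm below `5`, so `L ≥ 3` places them in the ball of radius `2^L`.
  have hR : (8 : ℝ) ≤ 2 ^ L := by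
    calc (8 : ℝ) = 2 ^ 3 := by norm_num
      _ ≤ 2 ^ L := pow_le_pow_right₀ (by norm_num) hL
  have hx1 := (norm_bounds_of_mem_farBall hx).1
  rw [roughT_testFun S k e ps a s (by linarith)]
  set box : Fin m → Set (RSpace n) := fun i =>
    if i = k then Metric.ball 0 1
    else if i ∈ S then Metric.ball (EuclideanSpace.single e (4 : ℝ)) 1
    else Metric.ball 0 (2 ^ L) with hbox
  have hboxm : MeasurableSet (Set.univ.pi box) := by
    refine MeasurableSet.univ_pi fun i => ?_
    simp only [hbox]
    split_ifs <;> exact measurableSet_ball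
  have hboxv : volume (Set.univ.pi box) =
      ENNReal.ofReal (v ^ m * dyadicWeight (-(n * Aᶜ.card)) 0 L) := by
    have h1 : ∀ i, volume (box i) =
        ENNReal.ofReal (v * if i ∈ Aᶜ then dyadicWeight (-n) 0 L else 1) := by
      intro i
      simp only [hbox, hA, Finset.mem_compl, Finset.mem_insert]
      by_cases h1 : i = k
      · simp [h1, hv, ofReal_measureReal measure_ball_lt_top.ne]
      by_cases h2 : i ∈ S
      · simp [h1, h2, hv, ofReal_measureReal measure_ball_lt_top.ne, Measure.addHaar_ball_center]
      · simp only [h1, h2, if_false, or_self, not_false_eq_true, if_true]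
        exact volume_ball_eq_dyadicWeight hn _ _
    rw [volume_pi_pi, Finset.prod_congr rfl fun i _ => h1 i, ← ENNReal.ofReal_prod_of_nonneg]
    · rw [Finset.prod_mul_distrib, Finset.prod_ite_mem, Finset.univ_inter, prod_dyadicWeight]
      simp [mul_comm]
    · intro i _
      refine mul_nonneg hv0.le ?_
      split_ifs
      · exact (dyadicWeight_pos _ _ _).le
      · exact zero_le_one
  have hlow : ∀ y ∈ Set.univ.pi box,
      c₁ * dyadicWeight (-s + (m * n : ℕ)) 1 L *
        dyadicWeight (∑ i ∈ Aᶜ, n / ps i) (∑ i ∈ Aᶜ, a i) L ≤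
      roughKernel (fun θ : USphere m n => diagSingular S k e s θ) (diagSub x y) *
          ∏ i, testFun S k e ps a i (y i) := by
    intro y hy
    have hyk : y k ∈ Metric.ball (0 : RSpace n) 1 := by simpa [hbox] using hy k (Set.mem_univ k)
    have hyS : ∀ i ∈ S, y i ∈ Metric.ball (EuclideanSpace.single e (4 : ℝ)) 1 := by
      intro i hiS
      have hi : i ≠ k := fun h => hk (h ▸ hiS)
      simpa only [hbox, hi, hiS, if_false, if_true] using hy i (Set.mem_univ i)
    have hyA : ∀ i ∈ Aᶜ, y i ∈ Metric.ball (0 : RSpace n) (2 ^ L) := by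
      intro i hi
      simp only [hA, Finset.mem_compl, Finset.mem_insert, not_or] at hi
      simpa only [hbox, hi.1, hi.2, if_false] using hy i (Set.mem_univ i)
    have hyn : ∀ i, ‖y i‖ ≤ 2 ^ L := by
      intro i
      by_cases hi : i ∈ A
      · rcases Finset.mem_insert.1 hi with rfl | hiS
        · have : ‖y i‖ < 1 := by simpa using hyk
          linarith
        · have h1 : ‖y i - EuclideanSpace.single e (4 : ℝ)‖ < 1 := by
            simpa [dist_eq_norm] using hyS i hiS
          have h2 : ‖EuclideanSpace.single e (4 : ℝ)‖ = 4 := by simp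
          have h3 := norm_sub_norm_le (y i) (EuclideanSpace.single e (4 : ℝ))
          linarith
      · exact (mem_ball_zero_iff.1 (hyA i (Finset.mem_compl.2 hi))).le
    have hker := le_roughKernel_diagSingular hS e hs hL hx hyk hyS hyn
    have hfun : dyadicWeight (∑ i ∈ Aᶜ, n / ps i) (∑ i ∈ Aᶜ, a i) L ≤
        ∏ i, testFun S k e ps a i (y i) := by
      rw [← prod_dyadicWeight, ← Finset.univ_inter Aᶜ, ← Finset.prod_ite_mem]
      refine Finset.prod_le_prod (fun i _ => ?_) fun i _ => ?_
      · split_ifs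
        · exact (dyadicWeight_pos _ _ _).le
        · exact zero_le_one
      · split_ifs with hi
        · have hyi := mem_ball_zero_iff.1 (hyA i hi)
          simp only [hA, Finset.mem_compl, Finset.mem_insert, not_or] at hi
          simp only [testFun, hi.1, hi.2, if_false]
          have := hps i
          refine dyadicWeight_anti (by positivity) (ha i) (dyadicIndex_le (hyi.trans ?_))
          rw [pow_succ]
          linarith
        · rw [Finset.mem_compl, not_not] at hi
          rcases Finset.mem_insert.1 hi with rfl | hiS
          · simp only [testFun, if_true, Set.indicator_of_mem hyk, Pi.one_apply, le_refl]
          · have hik : i ≠ k := fun h => hk (h ▸ hiS)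
            simp only [testFun, hik, hiS, if_false, if_true, Set.indicator_of_mem (hyS i hiS),
              Pi.one_apply, le_refl]
    exact mul_le_mul hker hfun (dyadicWeight_pos _ _ _).le
      ((mul_pos (by positivity) (dyadicWeight_pos _ _ _)).le.trans hker)
  calc _ ≤ ENNReal.ofReal (c₁ * dyadicWeight (-s + (m * n : ℕ)) 1 L *
        dyadicWeight (∑ i ∈ Aᶜ, n / ps i) (∑ i ∈ Aᶜ, a i) L) * volume (Set.univ.pi box) := by
        have h1 := dyadicWeight_pos (-s + (m * n : ℕ)) 1 L
        have h2 := dyadicWeight_pos (∑ i ∈ Aᶜ, n / ps i) (∑ i ∈ Aᶜ, a i) L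
        rw [hboxv, ← ENNReal.ofReal_mul (by positivity)]
        refine ENNReal.ofReal_le_ofReal ?_
        calc _ ≤ c₁ * v ^ m * (dyadicWeight (-s + (m * n : ℕ)) 1 L *
              dyadicWeight (∑ i ∈ Aᶜ, n / ps i) (∑ i ∈ Aᶜ, a i) L *
              dyadicWeight (-(n * Aᶜ.card)) 0 L) := by
              refine mul_le_mul_of_nonneg_left ?_ (by positivity)
              rw [dyadicWeight_mul, dyadicWeight_mul]
              -- Since `|A| + |Aᶜ| = m`, the box volume reduces `mn` from the kernel to `n|A|`, the
              -- exponent in `hσ`.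
              refine dyadicWeight_le_dyadicWeight ?_ (by linarith) L
              have h3 : (A.card : ℝ) + Aᶜ.card = m := by
                exact_mod_cast A.card_add_card_compl.trans (Fintype.card_fin m)
              push_cast
              rw [← h3]
              linarith
          _ = _ := by ring
    _ = ∫⁻ _ in Set.univ.pi box, ENNReal.ofReal (c₁ * dyadicWeight (-s + (m * n : ℕ)) 1 L *
        dyadicWeight (∑ i ∈ Aᶜ, n / ps i) (∑ i ∈ Aᶜ, a i) L) := by rw [setLIntegral_const]
    _ ≤ ∫⁻ y in Set.univ.pi box, ENNReal.ofReal
        (roughKernel (fun θ : USphere m n => diagSingular S k e s θ) (diagSub x y) *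
          ∏ i, testFun S k e ps a i (y i)) :=
        setLIntegral_mono' hboxm fun y hy => ENNReal.ofReal_le_ofReal (hlow y hy)
    _ ≤ _ := setLIntegral_le_lintegral _ _

/-! ### The violated condition and the choice of exponents -/

/-- A point outside the region violates the condition of some set of at least two indices. -/
lemma exists_of_not_mem_HRegion {m : ℕ} {q : ℝ} (hq : 1 < q) {t : Fin m → ℝ} (ht : ∀ i, t i < 1)
    (h : t ∉ HRegion m q) : ∃ (k : Fin m) (S : Finset (Fin m)), k ∉ S ∧ S.Nonempty ∧
      (S.card + 1 : ℝ) - S.card / q ≤ ∑ i ∈ insert k S, t i := by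
  simp only [HRegion, Set.mem_ofPred_eq, not_forall, not_lt] at h
  obtain ⟨α, hα⟩ := h
  set A : Finset (Fin m) := Finset.univ.filter fun i => α i = 1 with hA
  have h01 : ∀ i, ((α i : ℕ) : ℝ) = if i ∈ A then 1 else 0 := by
    intro i
    simp only [hA, Finset.mem_filter, Finset.mem_univ, true_and]
    rcases Fin.exists_fin_two.1 ⟨α i, rfl⟩ with h | h <;> simp [h]
  simp only [h01, ite_mul, one_mul, zero_mul, Finset.sum_ite_mem, Finset.univ_inter,
    Finset.sum_const, nsmul_eq_mul, mul_one] at hα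
  have hq0 : 0 < q := by linarith
  -- For the empty set the condition is `-1/q < 0`, which always holds.
  have hne : A.Nonempty := by
    rw [Finset.nonempty_iff_ne_empty]
    intro h0
    rw [h0] at hα
    have : 0 < 1 / q := by positivity
    simp only [Finset.card_empty, Finset.sum_empty, CharP.cast_eq_zero, zero_add, zero_sub,
      neg_div] at hα
    linarith
  obtain ⟨k, hk⟩ := hne
  have hkS : k ∉ A.erase k := Finset.notMem_erase k A
  have hins : insert k (A.erase k) = A := Finset.insert_erase hk
  have hcard : ((A.erase k).card : ℝ) + 1 = A.card := by
    exact_mod_cast Finset.card_erase_add_one hk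
  have hmain : ((A.erase k).card + 1 : ℝ) - (A.erase k).card / q ≤
      ∑ i ∈ insert k (A.erase k), t i := by
    rw [hins]
    have : ((A.card : ℝ) - 1) = (A.erase k).card := by linarith
    rw [this] at hα
    linarith
  refine ⟨k, A.erase k, hkS, ?_, hmain⟩
  -- If `S` were empty, the violated condition would say `1 ≤ t k`.
  rw [Finset.nonempty_iff_ne_empty]
  intro h0
  rw [h0] at hmain
  simp at hmain
  linarith [ht k]

theorem proposition1p3 (m n : ℕ) (hn : 1 ≤ n) (q p : ℝ) (hq : 1 < q) (ps : Fin m → ℝ)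
    (hps : ∀ i, 1 < ps i) (hp : 1 / p = ∑ i, 1 / ps i)
    (hH : (fun i => 1 / ps i) ∉ HRegion m q) :
    ∃ (Ω : USphere m n → ℝ) (f : Fin m → RSpace n → ℝ),
      (∀ θ, Ω (-θ) = -Ω θ) ∧
      MemLp Ω (ENNReal.ofReal q) (surfaceMeasure m n) ∧
      (∀ i, MemLp (f i) (ENNReal.ofReal (ps i)) volume) ∧
      ∫⁻ x, (roughT Ω f x).abs ^ p = ⊤ := by
  have hps0 : ∀ i, 0 < ps i := fun i => one_pos.trans (hps i)
  have hq0 : 0 < q := one_pos.trans hq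
  obtain ⟨k, S, hk, hS, hmain⟩ := exists_of_not_mem_HRegion hq
    (fun i => by rw [div_lt_one (hps0 i)]; exact hps i) hH
  have : Nonempty (Fin n) := ⟨⟨0, hn⟩⟩
  have hm : (0 : ℝ) < m := by exact_mod_cast (Nat.zero_le _).trans_lt k.2
  let e : Fin n := ⟨0, hn⟩
  set A := insert k S with hA
  have hAcard : (A.card : ℝ) = S.card + 1 := by
    rw [hA, Finset.card_insert_of_notMem hk]
    push_cast
    rfl
  have hsplit : ∑ i ∈ A, 1 / ps i + ∑ i ∈ Aᶜ, 1 / ps i = 1 / p := by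
    rw [hp, Finset.sum_add_sum_compl]
  have hSc : (1 : ℝ) ≤ S.card := by exact_mod_cast hS.card_pos
  have hδ : 1 < ∑ i ∈ A, 1 / ps i := by
    have : (S.card : ℝ) / q < S.card := div_lt_self (by linarith) hq
    linarith
  have hp0 : 0 < p := by
    rw [← one_div_pos, hp]
    exact Finset.sum_pos (fun i _ => one_div_pos.2 (hps0 i)) ⟨k, Finset.mem_univ k⟩
  -- The surplus of `∑_{i ∈ A} 1/p_i` over `1` is split into `m` equal shares: each `a i` exceeds `1
  -- / ps i`, as membership in `L^{p_i}` requires, while the total logarithmic loss stays within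
  -- `1/p`.
  set δ := (∑ i ∈ A, 1 / ps i - 1) / m with hδd
  have hδ0 : 0 < δ := div_pos (by linarith) hm
  let a : Fin m → ℝ := fun i => 1 / ps i + δ
  have ha : ∀ i, 0 ≤ a i := fun i => by have := hps0 i; positivity
  have hσ : -(n * S.card / q : ℝ) + n * A.card + ∑ i ∈ Aᶜ, n / ps i ≤ n / p := by
    have h1 : ∑ i ∈ Aᶜ, (n : ℝ) / ps i = n * ∑ i ∈ Aᶜ, 1 / ps i := by
      rw [Finset.mul_sum]
      exact Finset.sum_congr rfl fun i _ => by ring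
    have h2 : (n : ℝ) / p = n * (∑ i ∈ A, 1 / ps i + ∑ i ∈ Aᶜ, 1 / ps i) := by
      rw [hsplit]; ring
    rw [h1, h2, hAcard]
    have h3 := mul_le_mul_of_nonneg_left hmain (Nat.cast_nonneg (α := ℝ) n)
    have h4 : (n : ℝ) * S.card / q = n * (S.card / q) := by ring
    rw [h4]
    linarith
  have hτ : 1 + ∑ i ∈ Aᶜ, a i ≤ 1 / p := by
    simp only [a, Finset.sum_add_distrib, Finset.sum_const, nsmul_eq_mul]
    have h1 : (Aᶜ.card : ℝ) ≤ m := by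
      exact_mod_cast (Finset.card_le_univ _).trans_eq (Fintype.card_fin m)
    have h2 : (Aᶜ.card : ℝ) * δ ≤ m * δ := by gcongr
    have h3 : m * δ = ∑ i ∈ A, 1 / ps i - 1 := by rw [hδd]; field_simp
    linarith
  obtain ⟨c, hc, hlow⟩ := exists_le_roughT_testFun hn hS hk e hps0 ha
    (s := n * S.card / q) (by positivity) hσ hτ
  refine ⟨fun θ => diagSingular S k e (n * S.card / q) θ, testFun S k e ps a,
    fun θ => diagSingular_neg S k e _ θ, memLp_diagSingular hn hk e hq,
    fun i => memLp_testFun hn S k e (hps0 i) ?_, ?_⟩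
  · have := hps0 i
    simp only [a]
    rw [add_mul, one_div_mul_cancel this.ne']
    have := mul_pos hδ0 this
    linarith
  · refine lintegral_rpow_eq_top_of_dyadicWeight_le hp0 hc
      (v := volume.real (Metric.ball (0 : RSpace n) 1)) ?_ (E := farBall e)
      (fun j => measurableSet_ball) (pairwise_disjoint_farBall e) (L₀ := 3) (fun L _ => ?_) hlow
    · exact ENNReal.toReal_pos (Metric.measure_ball_pos _ _ one_pos).ne' measure_ball_lt_top.ne
    · rw [farBall, volume_ball_eq_dyadicWeight hn]
      simp [dyadicWeight]
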